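/- For $n\in\mathbb{Z}^+$ and a metric $d$ on a set $M$ of $n$ points, a point $p\in M$ is a $\beta$-approximate $1$-median of $(M,d)$ if $\sum_{y\in M}d(p,y)\le\beta\cdot\min_{x\in M}\sum_{y\in M}d(x,y)$. A deterministic algorithm for metric $1$-median is given $n$, and it accesses an unknown (real-valued) metric $d$ on $M=\{1,\dots,n\}$ only by queries: it repeatedly computes, from $n$ and the answers received so far, either a next pair $(a,b)\in M^2$, whereupon it receives $d(a,b)$, or an output point $z\in M$, whereupon it halts. As an algorithm it is effective: one partial recursive function, working for all $n$, computes its moves whenever the answers received are rational. The algorithm is $q(n)$-query if, for every $n\ge1$ and every metric on $\{1,\dots,n\}$, it halts with an output after at most $q(n)$ queries, and $\beta(n)$-approximate if, for every $n\ge 1$ and every such metric, its output is a $\beta(n)$-approximate $1$-median; it is $o(n)$-query (resp. $o(g(n))$-approximate) if it is $q(n)$-query for some $q(n)=o(n)$ (resp. $\beta(n)$-approximate for some $\beta(n)=o(g(n))$). **Theorem.** For each deterministic $o(n)$-query algorithm for metric $1$-median there is a computable function $f\colon\mathbb{Z}^+\to\mathbb{Z}^+$ with $f(n)=\omega(1)$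 (that is, $f(n)\to\infty$) such that the algorithm is not $o(f(n)\cdot\log n)$-approximate. -/

import Mathlib

open Filter Asymptotics

/-- `p` is a `β`-approximate `1`-median of the finite metric space `(M, m)`:
`∑ y, d(p, y) ≤ β * min_x ∑ y, d(x, y)`.  (For finite nonempty `M` the infimum is a minimum.) -/
def IsApproxMedian {M : Type*} [Fintype M] (m : MetricSpace M) (β : ℝ) (p : M) : Prop :=
  ∑ y, m.dist p y ≤ β * ⨅ x, ∑ y, m.dist x y

/-- The distance encoded by a pair of natural numbers: every nonnegative rational is
`a / (b + 1)` for some pair `(a, b)`. -/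
noncomputable def ratValue (c : ℕ × ℕ) : ℝ := (c.1 : ℝ) / ((c.2 : ℝ) + 1)

/-- A deterministic (possibly adaptive) query algorithm for metric `1`-median.

On the `n`-point set `Fin n` the algorithm knows `n` and the list `h` of the answers (distances)
received so far, oldest first. From these it computes its next move `step n h`:
* `Sum.inl (a, b)`: query the distance between the points `a` and `b`;
* `Sum.inr z`: stop and output the point `z`.
The computation of a move may fail to terminate (`step` is partial).
Being an algorithm, it is uniformly effective: when the answers are rational numbers,
given by numerators and denominators, the next move is computed by a partial recursive function of
`n` and the answers. -/
structure DetAlgorithm where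
  step : ℕ → List ℝ → Part ((ℕ × ℕ) ⊕ ℕ)
  effective : Partrec fun p : ℕ × List (ℕ × ℕ) => step p.1 (p.2.map ratValue)

namespace DetAlgorithm

/-- `A.Reaches m h`: when run on the metric space `(Fin n, m)`, the algorithm at some moment has
received exactly the list of answers `h`, all queries so far being pairs of points of the space. -/
inductive Reaches (A : DetAlgorithm) {n : ℕ} (m : MetricSpace (Fin n)) : List ℝ → Prop
  | start : Reaches A m []
  | query (h : List ℝ) (a b : Fin n) :
      Reaches A m h → Sum.inl ((a : ℕ), (b : ℕ)) ∈ A.step n h →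
      Reaches A m (h ++ [m.dist a b])

/-- When run on `(Fin n, m)`, the algorithm halts after exactly `k` queries and outputs `z`. -/
def Outputs (A : DetAlgorithm) {n : ℕ} (m : MetricSpace (Fin n)) (k : ℕ) (z : Fin n) : Prop :=
  ∃ h : List ℝ, A.Reaches m h ∧ h.length = k ∧ Sum.inr (z : ℕ) ∈ A.step n h

/-- The algorithm is a `q(n)`-query algorithm: on every metric space with point set
`Fin n`, `n ≥ 1`, it halts with an output in the space after at most `q n` queries. -/
def IsQueryAlgorithm (A : DetAlgorithm) (q : ℕ → ℕ) : Prop :=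
  ∀ n : ℕ, 0 < n → ∀ m : MetricSpace (Fin n), ∃ k ≤ q n, ∃ z, A.Outputs m k z

/-- The algorithm is `β(n)`-approximate: on every metric space with point set
`Fin n`, `n ≥ 1`, it halts and outputs a `β n`-approximate `1`-median. -/
def IsApproximation (A : DetAlgorithm) (β : ℕ → ℝ) : Prop :=
  ∀ n : ℕ, 0 < n → ∀ m : MetricSpace (Fin n),
    ∃ k z, A.Outputs m k z ∧ IsApproxMedian m (β n) z

/-- The algorithm is an `o(n)`-query algorithm. -/
def IsLittleOQuery (A : DetAlgorithm) : Prop :=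
  ∃ q : ℕ → ℕ, ((fun n => (q n : ℝ)) =o[atTop] fun n => (n : ℝ)) ∧ A.IsQueryAlgorithm q

/-- The algorithm is `o(g(n))`-approximate. -/
def IsLittleOApproximation (A : DetAlgorithm) (g : ℕ → ℝ) : Prop :=
  ∃ β : ℕ → ℝ, β =o[atTop] g ∧ A.IsApproximation β

end DetAlgorithm

/-! An adversary answers the queries from an integer metric `D`, initially constant `2n`. Let `E v =
∑ u, 2^(-D u v)` be `expSum`, and let `level` be about `log₂ E`. A query `(a, b)` is answered by
adding an edge of length `level a + level b`. As `level` is 1-Lipschitz, earlier answers survive; by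
the choice of length, `∑ E` grows by at most 2 per query (`sum_expSum_shortcut_le`). So after `k`
queries the levels of the `O(k)` queried points have sum `O(k)`.

Once `z` is output, the levels are raised near `z` to a Lipschitz `height` that is at least `p/2` at
`z` and has sum `O(k + 2^p)` (`sum_height_le`). Truncating `n * D` by sums of heights, with tiny
heights at unqueried points, keeps all answers. Then `z` costs about `n * n * p / 2`, while an
unqueried point costs `O(n * (k + 2^p))` (`exists_bad_metric`). With `2^p` about `√n`, the ratio is
of order `n * log n / (k + √n)`.

The bound `q` need not be computable. But the bad metrics have integer values at most `4n²`, so the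
maximum `K n` of the query counts over all such metrics is computable by simulation, and `K ≤ q =
o(n)`. This gives `f n = n / (K n + √n + 1) + 1`. -/

/-- The metric space structure given by a distance function with natural number values. -/
@[reducible] noncomputable def natMetricSpace {V : Type*} (d : V → V → ℕ) (h0 : ∀ a b, d a b = 0 ↔ a = b)
    (hs : ∀ a b, d a b = d b a) (ht : ∀ a b c, d a c ≤ d a b + d b c) : MetricSpace V where
  dist a b := (d a b : ℝ)
  dist_self a := by simp [(h0 a a).2 rfl]
  dist_comm a b := by rw [hs]
  dist_triangle a b c := by exact_mod_cast ht a b c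
  eq_of_dist_eq_zero {a b} h := (h0 a b).1 (by exact_mod_cast h)

/-! ### Coding bounded integer metrics by natural numbers -/

theorem exists_digits (N : ℕ) (g : ℕ → ℕ) (hg : ∀ i, g i < N) (m : ℕ) :
    ∃ x < N ^ m, ∀ i < m, x / N ^ i % N = g i := by
  induction m with
  | zero => exact ⟨0, by simp, by simp⟩
  | succ m ih =>
    obtain ⟨x, hx, hd⟩ := ih
    have hN : 0 < N := (Nat.zero_le _).trans_lt (hg 0)
    refine ⟨g m * N ^ m + x, ?_, fun i hi => ?_⟩
    · calc g m * N ^ m + x < g m * N ^ m + N ^ m := by omega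
        _ = (g m + 1) * N ^ m := by ring
        _ ≤ N * N ^ m := Nat.mul_le_mul_right _ (hg m)
        _ = N ^ (m + 1) := by ring
    · rcases Nat.lt_succ_iff_lt_or_eq.1 hi with h | rfl
      · rw [← hd i h]
        obtain ⟨j, rfl⟩ := Nat.exists_eq_add_of_lt h
        have : g (i + j + 1) * N ^ (i + j + 1) + x = x + N ^ i * (N * (g (i + j + 1) * N ^ j)) := by
          ring
        rw [this, Nat.add_mul_div_left _ _ (pow_pos hN i), Nat.add_mul_mod_self_left]
      · rw [Nat.mul_comm, Nat.mul_add_div (pow_pos hN _), Nat.div_eq_of_lt hx, Nat.add_zero,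
          Nat.mod_eq_of_lt (hg _)]

/-- A strict upper bound for the distances in a table. -/
def tableBase (n : ℕ) : ℕ := 4 * (n * n) + 1

/-- The distance table on `n` points encoded by the digits of `x`. -/
def tableDist (n x a b : ℕ) : ℕ := x / tableBase n ^ (a * n + b) % tableBase n

/-- The number of distance tables on `n` points. -/
def tableCount (n : ℕ) : ℕ := tableBase n ^ (n * n)

/-- The metric axioms for three points of a table. -/
def IsMetricTriple (n x a b c : ℕ) : Prop :=
  (tableDist n x a b = 0 ↔ a = b) ∧ tableDist n x a b = tableDist n x b a ∧
    tableDist n x a c ≤ tableDist n x a b + tableDist n x b c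

/-- The table encoded by `x` is a metric on a nonempty set of `n` points. -/
def IsMetricTable (n x : ℕ) : Prop :=
  0 < n ∧ ∀ a < n, ∀ b < n, ∀ c < n, IsMetricTriple n x a b c

theorem exists_table {n : ℕ} (d : Fin n → Fin n → ℕ) (hd : ∀ a b, d a b < tableBase n) :
    ∃ x < tableCount n, ∀ a b : Fin n, tableDist n x a b = d a b := by
  rcases Nat.eq_zero_or_pos n with rfl | hn
  · exact ⟨0, by simp [tableCount], fun a => a.elim0⟩
  obtain ⟨x, hx, h⟩ := exists_digits (tableBase n)
    (fun i => d ⟨i / n % n, Nat.mod_lt _ hn⟩ ⟨i % n, Nat.mod_lt _ hn⟩) (fun i => hd _ _) (n * n)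
  refine ⟨x, hx, fun a b => ?_⟩
  have hab : (a : ℕ) * n + b < n * n := by
    calc (a : ℕ) * n + b < a * n + n := by omega
      _ = (a + 1) * n := by ring
      _ ≤ n * n := Nat.mul_le_mul_right _ a.2
  rw [tableDist, h _ hab]
  congr
  · rw [Nat.mul_comm, Nat.mul_add_div hn, Nat.div_eq_of_lt b.2, Nat.add_zero, Nat.mod_eq_of_lt a.2]
  · rw [Nat.mul_comm, Nat.mul_add_mod, Nat.mod_eq_of_lt b.2]

theorem Primrec.nat_pow : Primrec₂ ((· ^ ·) : ℕ → ℕ → ℕ) := by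
  refine (Primrec.nat_rec (f := fun _ : ℕ => 1) (g := fun (a : ℕ) (p : ℕ × ℕ) => p.2 * a)
    (Primrec.const 1) ((Primrec.nat_mul.comp (Primrec.snd.comp Primrec.snd) Primrec.fst))).of_eq ?_
  intro a b
  induction b with
  | zero => simp
  | succ b ih => simp only [pow_succ]; rw [← ih]

theorem primrec_tableBase : Primrec tableBase :=
  Primrec.succ.comp (Primrec.nat_mul.comp (Primrec.const 4)
    (Primrec.nat_mul.comp Primrec.id Primrec.id))

theorem primrec_tableCount : Primrec tableCount :=
  Primrec.nat_pow.comp primrec_tableBase (Primrec.nat_mul.comp Primrec.id Primrec.id)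

theorem Primrec.tableDist {α : Type*} [Primcodable α] {n x a b : α → ℕ} (hn : Primrec n)
    (hx : Primrec x) (ha : Primrec a) (hb : Primrec b) :
    Primrec fun t => tableDist (n t) (x t) (a t) (b t) := by
  have hB := primrec_tableBase.comp hn
  exact Primrec.nat_mod.comp (Primrec.nat_div.comp hx (Primrec.nat_pow.comp hB
    (Primrec.nat_add.comp (Primrec.nat_mul.comp ha hn) hb))) hB

theorem PrimrecRel.forall_lt_param {β : Type*} [Primcodable β] {R : ℕ → β → Prop}
    (hf : PrimrecRel R) : PrimrecRel fun n y => ∀ x < n, R x y :=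
  (hf.forall_mem_list.comp (Primrec.list_range.comp Primrec.fst) Primrec.snd).of_eq (by simp)

theorem PrimrecPred.isMetricTriple {α : Type*} [Primcodable α] {n x a b c : α → ℕ}
    (hn : Primrec n) (hx : Primrec x) (ha : Primrec a) (hb : Primrec b) (hc : Primrec c) :
    PrimrecPred fun t => IsMetricTriple (n t) (x t) (a t) (b t) (c t) := by
  have e1 := Primrec.eq.comp (Primrec.tableDist hn hx ha hb) (Primrec.const 0)
  have e2 := Primrec.eq.comp ha hb
  have e3 := Primrec.eq.comp (Primrec.tableDist hn hx ha hb) (Primrec.tableDist hn hx hb ha)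
  have e4 := Primrec.nat_le.comp (Primrec.tableDist hn hx ha hc)
    (Primrec.nat_add.comp (Primrec.tableDist hn hx ha hb) (Primrec.tableDist hn hx hb hc))
  refine (((e1.and e2).or (e1.not.and e2.not)).and (e3.and e4)).of_eq fun t => ?_
  rw [← iff_iff_and_or_not_and_not]
  rfl

theorem primrecPred_isMetricTable : PrimrecPred fun p : ℕ × ℕ => IsMetricTable p.1 p.2 := by
  have h1 : PrimrecRel fun (c : ℕ) (q : ℕ × ℕ × ℕ × ℕ) =>
      IsMetricTriple q.2.2.1 q.2.2.2 q.2.1 q.1 c := by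
    have hs : Primrec fun t : ℕ × ℕ × ℕ × ℕ × ℕ => t.2.2 := Primrec.snd.comp Primrec.snd
    exact PrimrecPred.isMetricTriple (Primrec.fst.comp (Primrec.snd.comp hs))
      (Primrec.snd.comp (Primrec.snd.comp hs)) (Primrec.fst.comp hs)
      (Primrec.fst.comp Primrec.snd) Primrec.fst
  have h2 : PrimrecRel fun (b : ℕ) (q : ℕ × ℕ × ℕ) => ∀ c < q.2.1,
      IsMetricTriple q.2.1 q.2.2 q.1 b c :=
    PrimrecRel.comp (R := fun (m : ℕ) (q : ℕ × ℕ × ℕ × ℕ) => ∀ c < m,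
        IsMetricTriple q.2.2.1 q.2.2.2 q.2.1 q.1 c) h1.forall_lt_param
      (f := fun t : ℕ × ℕ × ℕ × ℕ => t.2.2.1) (g := fun t => t)
      (Primrec.fst.comp (Primrec.snd.comp Primrec.snd)) Primrec.id
  have h3 : PrimrecRel fun (a : ℕ) (q : ℕ × ℕ) => ∀ b < q.1, ∀ c < q.1,
      IsMetricTriple q.1 q.2 a b c :=
    PrimrecRel.comp (R := fun (m : ℕ) (q : ℕ × ℕ × ℕ) => ∀ b < m, ∀ c < q.2.1,
        IsMetricTriple q.2.1 q.2.2 q.1 b c) h2.forall_lt_param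
      (f := fun t : ℕ × ℕ × ℕ => t.2.1) (g := fun t => t)
      (Primrec.fst.comp Primrec.snd) Primrec.id
  exact (Primrec.nat_lt.comp (Primrec.const 0) Primrec.fst).and
    (PrimrecRel.comp (R := fun (m : ℕ) (q : ℕ × ℕ) => ∀ a < m, ∀ b < q.1, ∀ c < q.1,
        IsMetricTriple q.1 q.2 a b c) h3.forall_lt_param (f := fun t : ℕ × ℕ => t.1) (g := fun t => t)
      Primrec.fst Primrec.id)

namespace IsMetricTable

/-- The metric space given by a metric table. -/
@[reducible] noncomputable def metricSpace {n x : ℕ} (h : IsMetricTable n x) : MetricSpace (Fin n) :=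
  natMetricSpace (fun a b => tableDist n x a b)
    (fun a b => (h.2 a a.2 b b.2 b b.2).1.trans Fin.ext_iff.symm)
    (fun a b => (h.2 a a.2 b b.2 b b.2).2.1) (fun a b c => (h.2 a a.2 b b.2 c c.2).2.2)

end IsMetricTable

/-! ### Computability of the query count on coded metrics -/

namespace DetAlgorithm

variable (A : DetAlgorithm)

/-- One move of the algorithm, the queries being answered from a table. The algorithm halts with
the number of queries. -/
noncomputable def simStep (s : (ℕ × ℕ) × List (ℕ × ℕ)) : Part (ℕ ⊕ ((ℕ × ℕ) × List (ℕ × ℕ))) :=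
  (A.step s.1.1 (s.2.map ratValue)).map fun o =>
    Sum.casesOn o
      -- The pair `(c, 0)` has `ratValue` equal to `c / (0 + 1) = c`.
      (fun ab => Sum.inr (s.1, s.2 ++ [(tableDist s.1.1 s.1.2 ab.1 ab.2, 0)]))
      (fun _ => Sum.inl s.2.length)

theorem partrec_simStep : Partrec A.simStep := by
  have h1 : Partrec fun s : (ℕ × ℕ) × List (ℕ × ℕ) => A.step s.1.1 (s.2.map ratValue) :=
    A.effective.comp (Computable.pair (Computable.fst.comp Computable.fst) Computable.snd)
  refine h1.map (Computable.sumCasesOn (f := fun t : ((ℕ × ℕ) × List (ℕ × ℕ)) × ((ℕ × ℕ) ⊕ ℕ) => t.2)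
    (g := fun t ab => Sum.inr (t.1.1, t.1.2 ++ [(tableDist t.1.1.1 t.1.1.2 ab.1 ab.2, 0)]))
    (h := fun t _ => Sum.inl t.1.2.length) Computable.snd ?_ ?_)
  · refine Primrec.to_comp ?_
    have h : Primrec fun u : (((ℕ × ℕ) × List (ℕ × ℕ)) × ((ℕ × ℕ) ⊕ ℕ)) × (ℕ × ℕ) => u.1.1 :=
      Primrec.fst.comp Primrec.fst
    have hd := Primrec.tableDist (Primrec.fst.comp (Primrec.fst.comp h))
      (Primrec.snd.comp (Primrec.fst.comp h)) (Primrec.fst.comp Primrec.snd)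
      (Primrec.snd.comp Primrec.snd)
    exact Primrec.sumInr.comp (Primrec.pair (Primrec.fst.comp h)
      (Primrec.list_concat.comp (Primrec.snd.comp h) (Primrec.pair hd (Primrec.const 0))))
  · exact (Primrec.sumInl.comp (Primrec.list_length.comp
      (Primrec.snd.comp (Primrec.fst.comp Primrec.fst)))).to_comp

theorem Reaches.mem_fix_simStep {A : DetAlgorithm} {n x : ℕ} (hx : IsMetricTable n x) {h : List ℝ}
    (hr : A.Reaches hx.metricSpace h) : ∃ h' : List (ℕ × ℕ), h'.map ratValue = h ∧
      ∀ r, r ∈ PFun.fix A.simStep ((n, x), h') → r ∈ PFun.fix A.simStep ((n, x), []) := by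
  induction hr with
  | start => exact ⟨[], rfl, fun r hr => hr⟩
  | query h a b _ hs ih =>
    obtain ⟨h', rfl, ih⟩ := ih
    refine ⟨h' ++ [(tableDist n x a b, 0)], ?_, fun r hr => ih r ?_⟩
    · have : hx.metricSpace.dist a b = (tableDist n x a b : ℝ) := rfl
      simp [ratValue, this]
    · exact PFun.mem_fix_iff.2 (Or.inr ⟨_, Part.mem_map _ hs, hr⟩)

theorem Outputs.mem_fix_simStep {A : DetAlgorithm} {n x k : ℕ} {z : Fin n} (hx : IsMetricTable n x)
    (ho : A.Outputs hx.metricSpace k z) : k ∈ PFun.fix A.simStep ((n, x), []) := by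
  obtain ⟨h, hr, rfl, hz⟩ := ho
  obtain ⟨h', rfl, H⟩ := hr.mem_fix_simStep hx
  refine H _ (PFun.mem_fix_iff.2 (Or.inl ?_))
  have := Part.mem_map (fun o : (ℕ × ℕ) ⊕ ℕ =>
    (Sum.casesOn o
      (fun ab => Sum.inr ((n, x), h' ++ [(tableDist n x ab.1 ab.2, 0)]))
      (fun _ => Sum.inl h'.length) : ℕ ⊕ ((ℕ × ℕ) × List (ℕ × ℕ)))) hz
  simpa [simStep] using this

variable {A}

/-- The number of queries that a terminating algorithm makes on metric tables is computable. -/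
theorem IsQueryAlgorithm.exists_computable_queries {q : ℕ → ℕ} (hq : A.IsQueryAlgorithm q) :
    ∃ κ : ℕ × ℕ → ℕ, Computable κ ∧ (∀ n x, κ (n, x) ≤ q n) ∧
      ∀ n x (hx : IsMetricTable n x), ∃ z, A.Outputs hx.metricSpace (κ (n, x)) z := by
  classical
  -- Fixing the value 0 off the metric tables makes `κ` total and determines it there.
  have key : ∀ p : ℕ × ℕ, ∃ k ≤ q p.1, (∀ hx : IsMetricTable p.1 p.2,
      ∃ z, A.Outputs hx.metricSpace k z) ∧ (¬ IsMetricTable p.1 p.2 → k = 0) := by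
    intro p
    by_cases hx : IsMetricTable p.1 p.2
    · obtain ⟨k, hk, z, hz⟩ := hq p.1 hx.1 hx.metricSpace
      exact ⟨k, hk, fun _ => ⟨z, hz⟩, fun h => absurd hx h⟩
    · exact ⟨0, Nat.zero_le _, fun h => absurd h hx, fun _ => rfl⟩
  choose κ hκq hκo hκ0 using key
  refine ⟨κ, ?_, fun n x => hκq (n, x), fun n x => hκo (n, x)⟩
  obtain ⟨_, hdec⟩ := primrecPred_isMetricTable
  -- Being a metric table is decided before simulating, since halting is only guaranteed on metrics.
  have hp : Partrec fun p : ℕ × ℕ => cond (decide (IsMetricTable p.1 p.2))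
      (PFun.fix A.simStep (p, [])) (Part.some 0) :=
    Partrec.cond hdec.to_comp ((Partrec.fix A.partrec_simStep).comp
      (Computable.pair Computable.id (Computable.const []))) (Computable.const 0).partrec
  refine hp.of_eq_tot fun p => ?_
  by_cases hx : IsMetricTable p.1 p.2
  · obtain ⟨z, hz⟩ := hκo p hx
    simpa [hx] using hz.mem_fix_simStep hx
  · simp [hx, hκ0 p hx]

/-- The maximum of the first values of a computable function is computable. -/
theorem _root_.Computable.exists_max_below {κ : ℕ × ℕ → ℕ} (hκ : Computable κ) {G : ℕ → ℕ}
    (hG : Computable G) (q : ℕ → ℕ) (hq : ∀ n x, κ (n, x) ≤ q n) :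
    ∃ K : ℕ → ℕ, Computable K ∧ (∀ n, K n ≤ q n) ∧ ∀ n, ∀ x < G n, κ (n, x) ≤ K n := by
  refine ⟨fun n => Nat.rec 0 (fun x r => max r (κ (n, x))) (G n), ?_, fun n => ?_, fun n => ?_⟩
  · refine Computable.nat_rec hG (Computable.const 0)
      (h := fun (n : ℕ) (p : ℕ × ℕ) => max p.2 (κ (n, p.1))) ?_
    exact Primrec.nat_max.to_comp.comp (Computable.snd.comp Computable.snd)
      (hκ.comp (Computable.pair Computable.fst (Computable.fst.comp Computable.snd)))
  · dsimp only
    induction G n with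
    | zero => exact Nat.zero_le _
    | succ x ih => exact max_le ih (hq n x)
  · dsimp only
    induction G n with
    | zero => simp
    | succ y ih =>
      intro x hx
      rcases Nat.lt_succ_iff_lt_or_eq.1 hx with h | rfl
      · exact (ih x h).trans (le_max_left _ _)
      · exact le_max_right _ _

end DetAlgorithm

/-! ### Shortcuts and truncations of integer metrics -/

/-- A distance function with natural number values is a metric. -/
structure IsNatMetric {V : Type*} (D : V → V → ℕ) : Prop where
  eq_zero_iff : ∀ a b, D a b = 0 ↔ a = b
  symm : ∀ a b, D a b = D b a
  triangle : ∀ a b c, D a c ≤ D a b + D b c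

namespace IsNatMetric

section Shortcut

variable {V : Type*}

/-- The distances after joining `a` and `b` by a new edge of length `W`. -/
def shortcut (D : V → V → ℕ) (a b : V) (W : ℕ) (u v : V) : ℕ :=
  min (D u v) (min (D u a + W + D b v) (D u b + W + D a v))

theorem shortcut_le (D : V → V → ℕ) (a b : V) (W : ℕ) (u v : V) :
    shortcut D a b W u v ≤ D u v := min_le_left _ _

theorem shortcut_isNatMetric {D : V → V → ℕ} (hD : IsNatMetric D) (a b : V) {W : ℕ} (hW : 0 < W) :
    IsNatMetric (shortcut D a b W) where
  eq_zero_iff u v := by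
    rw [← hD.eq_zero_iff u v]
    simp only [shortcut]
    omega
  symm u v := by
    have := hD.symm u v
    have := hD.symm u a
    have := hD.symm u b
    have := hD.symm v a
    have := hD.symm v b
    simp only [shortcut]
    omega
  triangle u v w := by
    have := hD.triangle u v w
    have := hD.triangle u v a
    have := hD.triangle u v b
    have := hD.triangle a v w
    have := hD.triangle b v w
    have := hD.triangle u a w
    have := hD.triangle u b w
    simp only [shortcut]
    omega

/-- A metric truncated by the sums of a positive Lipschitz function is a metric. -/
theorem truncate {D : V → V → ℕ} (hD : IsNatMetric D) [DecidableEq V] {h : V → ℕ}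
    (h0 : ∀ v, 0 < h v) (hl : ∀ u v, h u ≤ h v + D u v) :
    IsNatMetric fun u v => if u = v then 0 else min (D u v) (h u + h v) where
  eq_zero_iff u v := by
    by_cases huv : u = v
    · simp [huv]
    · have := h0 u
      have := (hD.eq_zero_iff u v).not.2 huv
      simp only [huv, if_false, iff_false]
      omega
  symm u v := by simp only [eq_comm (a := u), hD.symm u v, add_comm (h u)]
  triangle u v w := by
    by_cases h1 : u = v
    · subst h1; simp
    by_cases h2 : v = w
    · subst h2; simp
    -- If just one leg is truncated, say to `h v + h w`, the Lipschitz bound `h u ≤ h v + D u v`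
    -- gives `h u + h w` below the sum of the legs.
    have := hD.triangle u v w
    have := hl u v
    have := hl w v
    have := hD.symm w v
    simp only [h1, h2, if_false]
    split_ifs <;> omega

theorem const_mul {D : V → V → ℕ} (hD : IsNatMetric D) {n : ℕ} (hn : 0 < n) :
    IsNatMetric fun u v => n * D u v where
  eq_zero_iff u v := by simp [hD.eq_zero_iff, hn.ne']
  symm u v := by simp only [hD.symm u v]
  triangle u v w := by
    simp only [← mul_add]
    exact Nat.mul_le_mul_left _ (hD.triangle u v w)

end Shortcut

/-! ### Exponential sums and levels -/

section Level

variable {V : Type*} [Fintype V] {D : V → V → ℕ}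

/-- The number of points, discounted exponentially in the distance to `v`. -/
noncomputable def expSum (D : V → V → ℕ) (v : V) : ℝ := ∑ u, (1 / 2 : ℝ) ^ D u v

theorem one_le_expSum (hD : IsNatMetric D) (v : V) : 1 ≤ expSum D v := by
  have := Finset.single_le_sum (f := fun u => (1 / 2 : ℝ) ^ D u v) (fun u _ => by positivity)
    (Finset.mem_univ v)
  simpa [(hD.eq_zero_iff v v).2 rfl, expSum] using this

theorem expSum_le_card (D : V → V → ℕ) (v : V) : expSum D v ≤ Fintype.card V := by
  calc expSum D v ≤ ∑ _u : V, (1 : ℝ) :=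
        Finset.sum_le_sum fun u _ => pow_le_one₀ (by norm_num) (by norm_num)
    _ = Fintype.card V := by simp

theorem exists_expSum_le (D : V → V → ℕ) (v : V) : ∃ k : ℕ, expSum D v ≤ 2 ^ k :=
  (pow_unbounded_of_one_lt (expSum D v) one_lt_two).imp fun _ h => h.le

open Classical in
/-- The logarithm of the exponentially discounted number of points, rounded up, plus one. -/
noncomputable def level (D : V → V → ℕ) (v : V) : ℕ := Nat.find (exists_expSum_le D v) + 1

theorem level_pos (D : V → V → ℕ) (v : V) : 0 < level D v := Nat.succ_pos _

theorem level_le {v : V} {k : ℕ} (h : expSum D v ≤ 2 ^ k) : level D v ≤ k + 1 :=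
  Nat.succ_le_succ (Nat.find_min' _ h)

theorem expSum_le_two_pow (D : V → V → ℕ) (v : V) : expSum D v ≤ 2 ^ (level D v - 1) :=
  Nat.find_spec (exists_expSum_le D v)

theorem expSum_le_two_pow_level (D : V → V → ℕ) (v : V) : expSum D v ≤ 2 ^ level D v :=
  (expSum_le_two_pow D v).trans (pow_le_pow_right₀ one_le_two (Nat.sub_le _ _))

/-- For a level `L ≥ 2`, minimality gives `2^(L-2) < expSum D v`, and `L ≤ 2^(L-2) + 1`. This turns
control of `∑ expSum` into control of the sum of levels. -/
theorem level_le_expSum_add_one (hD : IsNatMetric D) (v : V) :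
    (level D v : ℝ) ≤ expSum D v + 1 := by
  obtain h | h := Nat.eq_zero_or_pos (level D v - 1)
  · have h1 : level D v ≤ 1 := by omega
    have : (level D v : ℝ) ≤ 1 := by exact_mod_cast h1
    linarith [one_le_expSum hD v]
  · have h1 : (2 : ℝ) ^ (level D v - 2) < expSum D v := by
      by_contra! hc
      have := level_le hc
      omega
    have h2 : level D v ≤ 2 ^ (level D v - 2) + 1 := by
      have := Nat.lt_two_pow_self (n := level D v - 2)
      omega
    have h3 : (level D v : ℝ) ≤ 2 ^ (level D v - 2) + 1 := by exact_mod_cast h2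
    linarith

theorem level_le_card [Nonempty V] (D : V → V → ℕ) (v : V) : level D v ≤ Fintype.card V := by
  have hV := Fintype.card_pos (α := V)
  have h : expSum D v ≤ 2 ^ (Fintype.card V - 1) := by
    refine (expSum_le_card D v).trans ?_
    have := Nat.lt_two_pow_self (n := Fintype.card V - 1)
    have : Fintype.card V ≤ 2 ^ (Fintype.card V - 1) := by omega
    exact_mod_cast this
  have := level_le h
  omega

/-- By the triangle inequality, moving the base point from `v` to `u` multiplies each term of
`expSum` by at most `2 ^ D u v`. -/
theorem level_le_add_dist (hD : IsNatMetric D) (u v : V) : level D u ≤ level D v + D u v := by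
  have h : expSum D u ≤ 2 ^ (level D v - 1 + D u v) := by
    have h1 : expSum D u ≤ expSum D v * 2 ^ D u v := by
      rw [expSum, expSum, Finset.sum_mul]
      refine Finset.sum_le_sum fun w _ => ?_
      have : (1 / 2 : ℝ) ^ (D w u + D u v) ≤ (1 / 2) ^ D w v :=
        pow_le_pow_of_le_one (by norm_num) (by norm_num) (hD.triangle w u v)
      calc (1 / 2 : ℝ) ^ D w u = (1 / 2) ^ (D w u + D u v) * 2 ^ D u v := by
            rw [pow_add, mul_assoc, ← mul_pow]; norm_num
        _ ≤ _ := by gcongr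
    rw [pow_add]
    exact h1.trans (by gcongr; exact expSum_le_two_pow D v)
  have := level_le h
  have := level_pos D v
  omega

theorem level_mono {D' : V → V → ℕ} (h : ∀ u v, D' u v ≤ D u v) (v : V) :
    level D v ≤ level D' v := by
  have h1 : expSum D v ≤ 2 ^ (level D' v - 1) :=
    (Finset.sum_le_sum fun u _ => pow_le_pow_of_le_one (by norm_num) (by norm_num) (h u v)).trans
      (expSum_le_two_pow D' v)
  have := level_le h1
  have := level_pos D' v
  omega

/-- Paths through the new edge, in one direction, contribute at most `∑ u v, 2^(-D u a) * 2^(-W) *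
2^(-D b v) = E a * E b * 2^(-W)`. The length `W = level a + level b` makes this at most 1, and there
are two directions. -/
theorem sum_expSum_shortcut_le (hD : IsNatMetric D) (a b : V) :
    ∑ v, expSum (shortcut D a b (level D a + level D b)) v ≤ ∑ v, expSum D v + 2 := by
  set W := level D a + level D b with hW
  have h1 : ∀ u v, (1 / 2 : ℝ) ^ shortcut D a b W u v ≤ (1 / 2) ^ D u v +
      ((1 / 2) ^ D u a * (1 / 2) ^ D v b * (1 / 2) ^ W +
        (1 / 2) ^ D u b * (1 / 2) ^ D v a * (1 / 2) ^ W) := by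
    intro u v
    have e1 : (0 : ℝ) < (1 / 2) ^ D u v := by positivity
    have e2 : (0 : ℝ) < (1 / 2) ^ D u a * (1 / 2) ^ D v b * (1 / 2) ^ W := by positivity
    have e3 : (0 : ℝ) < (1 / 2) ^ D u b * (1 / 2) ^ D v a * (1 / 2) ^ W := by positivity
    rcases min_choice (D u v) (min (D u a + W + D b v) (D u b + W + D a v)) with h | h
    · rw [shortcut, h]; linarith
    · rw [shortcut, h]
      rcases min_choice (D u a + W + D b v) (D u b + W + D a v) with h | h
      · rw [h, hD.symm b v, pow_add, pow_add, mul_right_comm]; linarith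
      · rw [h, hD.symm a v, pow_add, pow_add, mul_right_comm]; linarith
  have h2 : expSum D a * expSum D b * (1 / 2) ^ W ≤ 1 := by
    have ha := expSum_le_two_pow_level D a
    have hb := expSum_le_two_pow_level D b
    have hb0 := one_le_expSum hD b
    calc expSum D a * expSum D b * (1 / 2) ^ W
        ≤ 2 ^ level D a * 2 ^ level D b * (1 / 2) ^ W := by gcongr
      _ = 1 := by rw [← pow_add, ← hW, ← mul_pow]; norm_num
  calc ∑ v, expSum (shortcut D a b W) v
      ≤ ∑ v, ∑ u, ((1 / 2 : ℝ) ^ D u v + ((1 / 2) ^ D u a * (1 / 2) ^ D v b * (1 / 2) ^ W +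
        (1 / 2) ^ D u b * (1 / 2) ^ D v a * (1 / 2) ^ W)) :=
        Finset.sum_le_sum fun v _ => Finset.sum_le_sum fun u _ => h1 u v
    _ = ∑ v, expSum D v + 2 * (expSum D a * expSum D b * (1 / 2) ^ W) := by
        simp only [Finset.sum_add_distrib, ← Finset.sum_mul, ← Finset.mul_sum]
        simp only [expSum]
        ring
    _ ≤ _ := by linarith

end Level

end IsNatMetric

/-! ### The adversary -/

open IsNatMetric

/-- The invariant of the adversary after `k` queries: `D` gives the answers to the pairs in `Q`,
and the points outside `T` have not been queried. -/
structure IsAdversaryState {V : Type*} [Fintype V] (k : ℕ) (D : V → V → ℕ) (Q : Set (V × V))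
    (T : Finset V) : Prop where
  metric : IsNatMetric D
  dist_le : ∀ p ∈ Q, D p.1 p.2 ≤ level D p.1 + level D p.2
  left_mem : ∀ p ∈ Q, p.1 ∈ T
  right_mem : ∀ p ∈ Q, p.2 ∈ T
  card_le : T.card ≤ 2 * k
  far : ∀ u y, y ∉ T → u ≠ y → 2 * Fintype.card V ≤ D u y
  sum_le : ∑ v, expSum D v ≤ Fintype.card V + 1 + 2 * k

namespace IsAdversaryState

variable {V : Type*} [Fintype V]

theorem initial [DecidableEq V] :
    IsAdversaryState (V := V) 0 (fun u v => if u = v then 0 else 2 * Fintype.card V) ∅ ∅ where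
  metric :=
    { eq_zero_iff := fun a b => by
        have : 0 < Fintype.card V := Fintype.card_pos_iff.2 ⟨a⟩
        by_cases h : a = b <;> simp [h, this.ne']
      symm := fun a b => by simp only [eq_comm (a := a)]
      triangle := fun a b c => by
        by_cases h : a = b
        · simp [h]
        · simp only [h, if_false]
          split_ifs <;> omega }
  dist_le := by simp
  left_mem := by simp
  right_mem := by simp
  card_le := by simp
  far u y _ h := by simp [h]
  sum_le := by
    set n := Fintype.card V with hn
    have h : ∀ v : V, expSum (fun u v : V => if u = v then 0 else 2 * n) v
        ≤ 1 + n * (1 / 2) ^ (2 * n) := by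
      intro v
      calc expSum (fun u v : V => if u = v then 0 else 2 * n) v
          ≤ ∑ u : V, ((if u = v then 1 else 0) + (1 / 2 : ℝ) ^ (2 * n)) := by
            refine Finset.sum_le_sum fun u _ => ?_
            by_cases h : u = v <;> simp [h]
        _ = _ := by simp [Finset.sum_add_distrib, ← hn]
    -- The off-diagonal terms add up to at most `n² * 2^(-2n)`, the square of this quantity.
    have h2 : (n : ℝ) * (1 / 2) ^ n ≤ 1 := by
      have : (n : ℝ) ≤ 2 ^ n := by exact_mod_cast Nat.lt_two_pow_self.le
      calc (n : ℝ) * (1 / 2) ^ n ≤ 2 ^ n * (1 / 2) ^ n := by gcongr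
        _ = 1 := by rw [← mul_pow]; norm_num
    calc _ ≤ ∑ _v : V, (1 + n * (1 / 2 : ℝ) ^ (2 * n)) := Finset.sum_le_sum fun v _ => h v
      _ = n + (n * (1 / 2 : ℝ) ^ n) * (n * (1 / 2 : ℝ) ^ n) := by simp [← hn]; ring
      _ ≤ n + 1 * 1 := by gcongr
      _ = _ := by simp

/-- The shortcut can only lower distances and hence only raise levels, so the bounds in `dist_le`
persist for the old pairs once their distances are seen to be unchanged. -/
theorem query {k : ℕ} {D : V → V → ℕ} {Q : Set (V × V)} {T : Finset V}
    (hS : IsAdversaryState k D Q T) (a b : V) :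
    ∃ D' Q' T', IsAdversaryState (k + 1) D' Q' T' ∧ (a, b) ∈ Q' ∧
      ∀ p ∈ Q, p ∈ Q' ∧ D' p.1 p.2 = D p.1 p.2 := by
  classical
  have hD := hS.metric
  set W := level D a + level D b with hW
  -- A detour for an old pair `(p₁, p₂)` through the new edge costs at least `level p₁ + level p₂`,
  -- by the Lipschitz property at both ends, hence at least `D p₁ p₂`.
  have hW0 : 0 < W := Nat.add_pos_left (level_pos D a) _
  have hle : ∀ u v, shortcut D a b W u v ≤ D u v := shortcut_le D a b W
  have hQ : ∀ p ∈ Q, shortcut D a b W p.1 p.2 = D p.1 p.2 := by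
    intro p hp
    have h0 := hS.dist_le p hp
    have h1 := level_le_add_dist hD p.1 a
    have h2 := level_le_add_dist hD p.1 b
    have h3 := level_le_add_dist hD p.2 a
    have h4 := level_le_add_dist hD p.2 b
    have h5 := hD.symm p.2 a
    have h6 := hD.symm p.2 b
    simp only [shortcut]
    omega
  refine ⟨shortcut D a b W, insert (a, b) Q, insert a (insert b T), ?_, by simp,
    fun p hp => ⟨Set.mem_insert_of_mem _ hp, hQ p hp⟩⟩
  refine ⟨shortcut_isNatMetric hD a b hW0, ?_, ?_, ?_, ?_, ?_, ?_⟩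
  · rintro p (rfl | hp)
    · have h1 := level_mono hle a
      have h2 := level_mono hle b
      have h3 := (hD.eq_zero_iff a a).2 rfl
      have h4 := (hD.eq_zero_iff b b).2 rfl
      calc shortcut D a b W a b ≤ W := by simp only [shortcut]; omega
        _ ≤ _ := Nat.add_le_add h1 h2
    · rw [hQ p hp]
      exact (hS.dist_le p hp).trans (Nat.add_le_add (level_mono hle _) (level_mono hle _))
  · rintro p (rfl | hp)
    · simp
    · simp [hS.left_mem p hp]
  · rintro p (rfl | hp)
    · simp
    · simp [hS.right_mem p hp]
  · have h1 := Finset.card_insert_le a (insert b T)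
    have h2 := Finset.card_insert_le b T
    have := hS.card_le
    omega
  · intro u y hy huy
    simp only [Finset.mem_insert, not_or] at hy
    have h1 := hS.far u y hy.2.2 huy
    have h2 := hS.far a y hy.2.2 (Ne.symm hy.1)
    have h3 := hS.far b y hy.2.2 (Ne.symm hy.2.1)
    simp only [shortcut]
    omega
  · have := sum_expSum_shortcut_le hD a b
    have := hS.sum_le
    push_cast
    linarith

/-! ### Completion to a metric in which the output is bad -/

/-- A height function on the queried points that is consistent with the answers, large at `z` and
small on average. -/
noncomputable def height (D : V → V → ℕ) (p : ℕ) (z v : V) : ℕ :=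
  max (level D v) (p - level D z - D z v)

variable {k : ℕ} {D : V → V → ℕ} {Q : Set (V × V)} {T : Finset V}

theorem height_pos (p : ℕ) (z v : V) : 0 < height D p z v :=
  (level_pos D v).trans_le (le_max_left _ _)

theorem height_le_add_dist (hD : IsNatMetric D) (p : ℕ) (z u v : V) :
    height D p z u ≤ height D p z v + D u v := by
  have := level_le_add_dist hD u v
  have := hD.triangle z u v
  simp only [height]
  omega

/-- One of `level D z` and `p - level D z` is at least `p / 2`. -/
theorem le_two_mul_height (hD : IsNatMetric D) (p : ℕ) (z : V) : p ≤ 2 * height D p z z := by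
  have := (hD.eq_zero_iff z z).2 rfl
  simp only [height]
  omega

/-- The levels contribute at most `(2k + 1) + 2 * (2k + 1)`, from the excess of `∑ expSum` over the
number of points. For the bump at `z`, `x ≤ 2^x` bounds the sum by `2^p * 2^(-level z) * E z ≤ 2^p`.
-/
theorem sum_height_le (hS : IsAdversaryState k D Q T) (p : ℕ) (z : V) (T' : Finset V)
    (hT' : T'.card ≤ 2 * k + 1) : ∑ v ∈ T', (height D p z v : ℝ) ≤ 6 * k + 3 + 2 ^ p := by
  have hD := hS.metric
  have h1 : ∀ v, (height D p z v : ℝ) ≤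
      (expSum D v - 1) + 2 + 2 ^ p * (1 / 2) ^ level D z * (1 / 2) ^ D v z := by
    intro v
    have e1 : height D p z v ≤ level D v + (p - level D z - D z v) := by
      simp only [height]; omega
    have e2 : ((p - level D z - D z v : ℕ) : ℝ) ≤
        2 ^ p * (1 / 2) ^ level D z * (1 / 2) ^ D v z := by
      rw [hD.symm v z]
      rcases le_total p (level D z + D z v) with h | h
      · have : p - level D z - D z v = 0 := by omega
        rw [this, Nat.cast_zero]
        positivity
      · obtain ⟨x, hx⟩ := Nat.exists_eq_add_of_le h
        have hx' : p - level D z - D z v = x := by omega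
        have : (2 : ℝ) ^ p * (1 / 2) ^ level D z * (1 / 2) ^ D z v = 2 ^ x := by
          rw [hx, pow_add, pow_add, one_div, inv_pow, inv_pow]
          field_simp
        rw [hx', this]
        exact_mod_cast Nat.lt_two_pow_self.le
    have e3 : (height D p z v : ℝ) ≤ level D v + ((p - level D z - D z v : ℕ) : ℝ) := by
      exact_mod_cast e1
    linarith [level_le_expSum_add_one hD v]
  have h2 : ∑ v ∈ T', (expSum D v - 1) ≤ 2 * k + 1 := by
    calc ∑ v ∈ T', (expSum D v - 1) ≤ ∑ v, (expSum D v - 1) :=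
          Finset.sum_le_sum_of_subset_of_nonneg (Finset.subset_univ _)
            fun v _ _ => sub_nonneg.2 (one_le_expSum hD v)
      _ ≤ 2 * k + 1 := by
          have := hS.sum_le
          simp only [Finset.sum_sub_distrib, Finset.sum_const, Finset.card_univ, nsmul_eq_mul]
          linarith
  have h3 : ∑ v ∈ T', (2 : ℝ) ^ p * (1 / 2) ^ level D z * (1 / 2) ^ D v z ≤ 2 ^ p := by
    have hz := expSum_le_two_pow_level D z
    calc ∑ v ∈ T', (2 : ℝ) ^ p * (1 / 2) ^ level D z * (1 / 2) ^ D v z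
        ≤ ∑ v, (2 : ℝ) ^ p * (1 / 2) ^ level D z * (1 / 2) ^ D v z :=
          Finset.sum_le_sum_of_subset_of_nonneg (Finset.subset_univ _) fun v _ _ => by positivity
      _ = 2 ^ p * (1 / 2) ^ level D z * expSum D z := by rw [← Finset.mul_sum, expSum]
      _ ≤ 2 ^ p * (1 / 2) ^ level D z * 2 ^ level D z := by gcongr
      _ = 2 ^ p := by rw [mul_assoc, ← mul_pow]; norm_num
  have hc : (T'.card : ℝ) ≤ 2 * k + 1 := by exact_mod_cast hT'
  calc ∑ v ∈ T', (height D p z v : ℝ) ≤ ∑ v ∈ T', ((expSum D v - 1) + 2 +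
        2 ^ p * (1 / 2) ^ level D z * (1 / 2) ^ D v z) := Finset.sum_le_sum fun v _ => h1 v
    _ ≤ _ := by
      simp only [Finset.sum_add_distrib (s := T'), Finset.sum_const, nsmul_eq_mul]
      linarith

/-- The answers of the adversary can be completed to a metric in which `z` is a bad median. -/
theorem exists_bad_metric (hS : IsAdversaryState k D Q T) (z : V) {p : ℕ}
    (hp : p ≤ 2 * Fintype.card V) (hk : 2 * k + 1 < Fintype.card V) :
    ∃ d : V → V → ℕ, IsNatMetric d ∧
      (∀ u v, d u v ≤ 4 * (Fintype.card V * Fintype.card V)) ∧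
      (∀ q ∈ Q, d q.1 q.2 = Fintype.card V * D q.1 q.2) ∧
      ∃ y, ((Fintype.card V : ℝ) - 2 * k - 1) * p * ∑ v, (d y v : ℝ) ≤
        2 * (6 * k + 5 + 2 ^ p) * ∑ v, (d z v : ℝ) := by
  classical
  have hD := hS.metric
  have : Nonempty V := ⟨z⟩
  set n := Fintype.card V with hn
  have hn0 : 0 < n := by omega
  set T' := insert z T with hT'
  have hcard : T'.card ≤ 2 * k + 1 := by
    have := hS.card_le
    exact (Finset.card_insert_le z T).trans (by omega)
  have hg : ∀ v, height D p z v ≤ 2 * n := by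
    intro v
    have := level_le_card D v
    simp only [height]
    omega
  set h : V → ℕ := fun v => if v ∈ T' then n * height D p z v else 1 with hh
  have hT : ∀ v ∈ T', h v = n * height D p z v := fun v hv => by simp [hh, hv]
  have hC : ∀ v, v ∉ T' → h v = 1 := fun v hv => by simp [hh, hv]
  have hpos : ∀ v, 0 < h v := by
    intro v
    by_cases hv : v ∈ T'
    · rw [hT v hv]; exact Nat.mul_pos hn0 (height_pos p z v)
    · rw [hC v hv]; exact Nat.one_pos
  have hle : ∀ v, h v ≤ n * (2 * n) := by
    intro v
    by_cases hv : v ∈ T'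
    · rw [hT v hv]; exact Nat.mul_le_mul_left _ (hg v)
    · rw [hC v hv]; exact Nat.mul_pos hn0 (by omega)
  have hfar : ∀ u v, v ∉ T' → u ≠ v → 2 * n ≤ D u v := fun u v hv huv =>
    hS.far u v (fun h => hv (Finset.mem_insert_of_mem h)) huv
  have hlip : ∀ u v, h u ≤ h v + n * D u v := by
    intro u v
    by_cases huv : u = v
    · simp [huv]
    by_cases hv : v ∈ T'
    · by_cases hu : u ∈ T'
      · rw [hT u hu, hT v hv, ← mul_add]
        exact Nat.mul_le_mul_left _ (height_le_add_dist hD p z u v)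
      · rw [hC u hu]
        have := hpos v
        omega
    · have := Nat.mul_le_mul_left n (hfar u v hv huv)
      have := hle u
      omega
  refine ⟨_, (hD.const_mul hn0).truncate hpos hlip, fun u v => ?_, fun q hq => ?_, ?_⟩
  · have := hle u
    have := hle v
    have : n * (2 * n) = 2 * (n * n) := by ring
    split_ifs <;> omega
  -- Truncation spares the answers: they are at most sums of levels, hence of heights.
  · have h1 : q.1 ∈ T' := Finset.mem_insert_of_mem (hS.left_mem q hq)
    have h2 : q.2 ∈ T' := Finset.mem_insert_of_mem (hS.right_mem q hq)
    split_ifs with he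
    · simp [he, (hD.eq_zero_iff q.2 q.2).2 rfl]
    · rw [hT _ h1, hT _ h2, ← mul_add, min_eq_left]
      refine Nat.mul_le_mul_left _ ((hS.dist_le q hq).trans ?_)
      exact Nat.add_le_add (le_max_left _ _) (le_max_left _ _)
  · set d : V → V → ℕ := fun u v => if u = v then 0 else min (n * D u v) (h u + h v) with hd
    obtain ⟨y, hy⟩ : ∃ y, y ∉ T' := by
      by_contra! hall
      have : T' = Finset.univ := Finset.eq_univ_iff_forall.2 hall
      rw [this, Finset.card_univ] at hcard
      omega
    refine ⟨y, ?_⟩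
    have hcy : ∑ v, (d y v : ℝ) ≤ n * (6 * k + 5 + 2 ^ p) := by
      have e1 : ∀ v, (d y v : ℝ) ≤ 2 + (if v ∈ T' then (n * height D p z v : ℝ) else 0) := by
        intro v
        have : d y v ≤ 1 + h v := by
          simp only [hd, hC y hy]
          split_ifs <;> omega
        have : (d y v : ℝ) ≤ 1 + h v := by exact_mod_cast this
        by_cases hv : v ∈ T'
        · rw [hT v hv] at this
          push_cast at this
          simp only [hv, if_true]
          linarith
        · rw [hC v hv] at this
          push_cast at this
          simp only [hv, if_false]
          linarith
      calc ∑ v, (d y v : ℝ)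
          ≤ ∑ v, (2 + (if v ∈ T' then (n * height D p z v : ℝ) else 0)) :=
            Finset.sum_le_sum fun v _ => e1 v
        _ = n * (2 + ∑ v ∈ T', (height D p z v : ℝ)) := by
            rw [Finset.sum_add_distrib, Finset.sum_ite_mem, Finset.univ_inter, ← Finset.mul_sum]
            simp [← hn]
            ring
        _ ≤ n * (2 + (6 * k + 3 + 2 ^ p)) := by
            gcongr
            exact sum_height_le hS p z T' hcard
        _ = _ := by ring
    -- From `z` to any point outside `T'`, both `n * D` and the sum of heights are at least `n *
    -- height D p z z`.
    have hcz : ((n : ℝ) - 2 * k - 1) * (n * height D p z z) ≤ ∑ v, (d z v : ℝ) := by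
      have e1 : ∀ v ∈ T'ᶜ, n * height D p z z ≤ d z v := by
        intro v hv
        rw [Finset.mem_compl] at hv
        have hzT : z ∈ T' := Finset.mem_insert_self _ _
        have hzv : z ≠ v := fun e => hv (e ▸ hzT)
        simp only [hd, hzv, if_false, hT z hzT]
        refine le_min (Nat.mul_le_mul_left _ ((hg z).trans (hfar z v hv hzv))) (Nat.le_add_right _ _)
      have e2 : (n : ℝ) - 2 * k - 1 ≤ (T'ᶜ.card : ℝ) := by
        have : n ≤ T'ᶜ.card + (2 * k + 1) := by rw [Finset.card_compl]; omega
        have : (n : ℝ) ≤ T'ᶜ.card + (2 * k + 1) := by exact_mod_cast this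
        linarith
      calc ((n : ℝ) - 2 * k - 1) * (n * height D p z z)
          ≤ T'ᶜ.card * (n * height D p z z) := by gcongr
        _ = ∑ _v ∈ T'ᶜ, (n * height D p z z : ℝ) := by simp
        _ ≤ ∑ v ∈ T'ᶜ, (d z v : ℝ) := Finset.sum_le_sum fun v hv => by exact_mod_cast e1 v hv
        _ ≤ ∑ v, (d z v : ℝ) :=
            Finset.sum_le_sum_of_subset_of_nonneg (Finset.subset_univ _) fun v _ _ => by positivity
    have hpz : (p : ℝ) ≤ 2 * height D p z z := by exact_mod_cast le_two_mul_height hD p z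
    have hm : (0 : ℝ) ≤ (n : ℝ) - 2 * k - 1 := by
      have : (2 * k + 1 : ℝ) ≤ n := by exact_mod_cast hk.le
      linarith
    calc ((n : ℝ) - 2 * k - 1) * p * ∑ v, (d y v : ℝ)
        ≤ ((n : ℝ) - 2 * k - 1) * (2 * height D p z z) * (n * (6 * k + 5 + 2 ^ p)) := by gcongr
      _ = 2 * (6 * k + 5 + 2 ^ p) * (((n : ℝ) - 2 * k - 1) * (n * height D p z z)) := by ring
      _ ≤ _ := by gcongr

end IsAdversaryState

/-! ### Running the algorithm against the adversary -/

/-- The metric space given by a metric with natural number values. -/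
@[reducible] noncomputable def IsNatMetric.metricSpace {V : Type*} {D : V → V → ℕ}
    (hD : IsNatMetric D) : MetricSpace V :=
  natMetricSpace D hD.eq_zero_iff hD.symm hD.triangle

namespace DetAlgorithm

variable {A : DetAlgorithm} {n : ℕ} {m : MetricSpace (Fin n)}

theorem Reaches.exists_query {g : List ℝ} (hg : A.Reaches m g) :
    ∀ (h : List ℝ) (x : ℝ) (t : List ℝ), g = h ++ x :: t →
      ∃ a b : Fin n, Sum.inl ((a : ℕ), (b : ℕ)) ∈ A.step n h ∧ x = m.dist a b := by
  induction hg with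
  | start => simp
  | query g a b _ hs ih =>
    intro h x t e
    rcases List.eq_nil_or_concat t with rfl | ⟨t', y, rfl⟩
    · obtain ⟨rfl, e2⟩ := List.append_inj' e rfl
      exact ⟨a, b, hs, by simpa using e2.symm⟩
    · rw [List.concat_eq_append, ← List.cons_append, ← List.append_assoc] at e
      exact ih h x t' (List.append_inj' e rfl).1

/-- By determinism, two runs on the same metric agree until one stops, and a history that ends in an
output cannot be extended. -/
theorem Reaches.prefix_of_output {h g : List ℝ} {z : ℕ} (hr : A.Reaches m h) (hg : A.Reaches m g)
    (hz : Sum.inr z ∈ A.step n g) : ∃ t, g = h ++ t := by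
  induction hr with
  | start => exact ⟨g, rfl⟩
  | query h a b _ hs ih =>
    obtain ⟨t, rfl⟩ := ih
    rcases t with _ | ⟨x, t⟩
    · rw [List.append_nil] at hz
      exact absurd (Part.mem_unique hs hz) (by simp)
    · obtain ⟨a', b', hs', rfl⟩ := hg.exists_query h x t rfl
      have e := Part.mem_unique hs hs'
      simp only [Sum.inl.injEq, Prod.mk.injEq, Fin.val_inj] at e
      obtain ⟨rfl, rfl⟩ := e
      exact ⟨t, by simp⟩

theorem Outputs.unique {k k' : ℕ} {z z' : Fin n} (h : A.Outputs m k z) (h' : A.Outputs m k' z') :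
    k = k' ∧ z = z' := by
  obtain ⟨g, hg, rfl, hz⟩ := h
  obtain ⟨g', hg', rfl, hz'⟩ := h'
  obtain ⟨t, rfl⟩ := hg.prefix_of_output hg' hz'
  obtain ⟨t', e⟩ := hg'.prefix_of_output hg hz
  have : t = [] := by
    have := congrArg List.length e
    simp only [List.length_append] at this
    exact List.length_eq_zero_iff.1 (by omega)
  subst this
  rw [List.append_nil] at hz' ⊢
  exact ⟨rfl, Fin.ext (by simpa using Part.mem_unique hz hz')⟩

/-- A terminating algorithm halts against the adversary. -/
theorem IsQueryAlgorithm.exists_adversaryState {q : ℕ → ℕ} (hq : A.IsQueryAlgorithm q)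
    (hn : 0 < n) : ∃ k D Q T z, IsAdversaryState (V := Fin n) k D Q T ∧
      ∀ m : MetricSpace (Fin n), (∀ p ∈ Q, m.dist p.1 p.2 = ((n * D p.1 p.2 : ℕ) : ℝ)) →
        A.Outputs m k z := by
  -- If no adversary state forced an output, the game could be prolonged to `q n + 1` queries,
  -- against the query bound on the single metric `n * D`.
  by_contra hcon
  have key : ∀ k : ℕ, ∃ D Q T h, IsAdversaryState (V := Fin n) k D Q T ∧ h.length = k ∧
      ∀ m : MetricSpace (Fin n), (∀ p ∈ Q, m.dist p.1 p.2 = ((n * D p.1 p.2 : ℕ) : ℝ)) →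
        A.Reaches m h := by
    intro k
    induction k with
    | zero => exact ⟨_, _, _, [], IsAdversaryState.initial, rfl, fun m _ => Reaches.start⟩
    | succ k ih =>
      obtain ⟨D, Q, T, h, hS, hk, hR⟩ := ih
      have hr := hR (hS.metric.const_mul hn).metricSpace fun p _ => rfl
      -- The next move is read off from the halting run on the current metric `n * D`; this ensures
      -- that the move exists and that a query lies in `Fin n`.
      obtain ⟨_, _, z, g, hg, rfl, hz⟩ := hq n hn (hS.metric.const_mul hn).metricSpace
      obtain ⟨t, rfl⟩ := hr.prefix_of_output hg hz
      rcases t with _ | ⟨x, t⟩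
      · rw [List.append_nil] at hz
        exact absurd ⟨k, D, Q, T, z, hS, fun m hm => ⟨h, hR m hm, hk, hz⟩⟩ hcon
      · obtain ⟨a, b, hs, -⟩ := hg.exists_query h x t rfl
        obtain ⟨D', Q', T', hS', hab, hQ⟩ := hS.query a b
        refine ⟨D', Q', T', h ++ [((n * D' a b : ℕ) : ℝ)], hS', by simp [hk], fun m hm => ?_⟩
        rw [← hm _ hab]
        refine Reaches.query h a b (hR m fun p hp => ?_) hs
        rw [hm p (hQ p hp).1, (hQ p hp).2]
  obtain ⟨D, Q, T, h, hS, hk, hR⟩ := key (q n + 1)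
  have hr := hR (hS.metric.const_mul hn).metricSpace fun p _ => rfl
  obtain ⟨k', hk', z, g, hg, rfl, hz⟩ := hq n hn (hS.metric.const_mul hn).metricSpace
  obtain ⟨t, rfl⟩ := hr.prefix_of_output hg hz
  rw [List.length_append] at hk'
  omega

/-- On some metric table, the cost of the output is much larger than that of another point. -/
theorem IsQueryAlgorithm.exists_bad_table {q : ℕ → ℕ} (hq : A.IsQueryAlgorithm q) {p : ℕ}
    (hp : p ≤ 2 * n) (hn : 2 * q n + 1 < n) :
    ∃ x < tableCount n, ∃ hx : IsMetricTable n x, ∃ k z, A.Outputs hx.metricSpace k z ∧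
      ∃ y, ((n : ℝ) - 2 * k - 1) * p * ∑ v, hx.metricSpace.dist y v ≤
        2 * (6 * k + 5 + 2 ^ p) * ∑ v, hx.metricSpace.dist z v := by
  have hn0 : 0 < n := by omega
  obtain ⟨k, D, Q, T, z, hS, hO⟩ := hq.exists_adversaryState hn0
  have hk : k ≤ q n := by
    obtain ⟨k', hk', z', hz'⟩ := hq n hn0 (hS.metric.const_mul hn0).metricSpace
    rwa [((hO _ fun _ _ => rfl).unique hz').1]
  obtain ⟨d, hd, hdle, hdQ, y, hy⟩ := hS.exists_bad_metric z (p := p) (by simpa using hp)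
    (by rw [Fintype.card_fin]; omega)
  rw [Fintype.card_fin] at hdle hdQ hy
  obtain ⟨x, hxlt, hx⟩ := exists_table d fun a b => Nat.lt_succ_of_le (hdle a b)
  have hxm : IsMetricTable n x := by
    refine ⟨hn0, fun a ha b hb c hc => ?_⟩
    have h1 := hx ⟨a, ha⟩ ⟨b, hb⟩
    have h2 := hx ⟨b, hb⟩ ⟨a, ha⟩
    have h3 := hx ⟨a, ha⟩ ⟨c, hc⟩
    have h4 := hx ⟨b, hb⟩ ⟨c, hc⟩
    dsimp only at h1 h2 h3 h4
    rw [IsMetricTriple, h1, h2, h3, h4]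
    exact ⟨(hd.eq_zero_iff _ _).trans Fin.ext_iff, hd.symm _ _, hd.triangle _ _ _⟩
  have hdist : ∀ a b, hxm.metricSpace.dist a b = (d a b : ℝ) := fun a b =>
    congrArg Nat.cast (hx a b)
  refine ⟨x, hxlt, hxm, k, z, hO _ fun r hr => ?_, y, ?_⟩
  · rw [hdist, hdQ r hr]
  · simpa only [hdist] using hy

end DetAlgorithm

/-! ### Asymptotics and conclusion -/

/-- The infimum of a nonnegative function, scaled, is at most a scaled value. -/
theorem mul_iInf_le_abs_mul {ι : Type*} [Finite ι] (s : ι → ℝ) (hs : ∀ i, 0 ≤ s i) (β : ℝ) (y : ι) :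
    β * ⨅ x, s x ≤ |β| * s y :=
  calc β * ⨅ x, s x ≤ |β| * ⨅ x, s x :=
        mul_le_mul_of_nonneg_right (le_abs_self β) (Real.iInf_nonneg hs)
    _ ≤ |β| * s y :=
        mul_le_mul_of_nonneg_left (ciInf_le (Set.finite_range s).bddBelow y) (abs_nonneg β)

theorem log_le_four_mul_log_sqrt {n : ℕ} (hn : 4 ≤ n) :
    Real.log n ≤ 4 * (Nat.log 2 n.sqrt : ℝ) := by
  set p := Nat.log 2 n.sqrt with hp
  have h2 : 2 ≤ n.sqrt := Nat.le_sqrt.2 hn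
  have hp1 : 1 ≤ p := Nat.log_pos one_lt_two h2
  have h3 : n.sqrt + 1 ≤ 2 ^ (p + 1) := Nat.lt_pow_succ_log_self one_lt_two _
  have h4 : n ≤ 2 ^ (4 * p) :=
    calc n ≤ (n.sqrt + 1) * (n.sqrt + 1) := (Nat.lt_succ_sqrt n).le
      _ ≤ 2 ^ (p + 1) * 2 ^ (p + 1) := Nat.mul_le_mul h3 h3
      _ = 2 ^ (2 * p + 2) := by rw [← pow_add]; ring_nf
      _ ≤ 2 ^ (4 * p) := Nat.pow_le_pow_right two_pos (by omega)
  have h5 : (n : ℝ) ≤ 2 ^ (4 * p) := by exact_mod_cast h4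
  have hn0 : (0 : ℝ) < n := by exact_mod_cast (by omega : 0 < n)
  calc Real.log n ≤ Real.log (2 ^ (4 * p)) := Real.log_le_log hn0 h5
    _ = 4 * p * Real.log 2 := by rw [Real.log_pow]; push_cast; ring
    _ ≤ 4 * p * 1 := by
        gcongr
        linarith [Real.log_two_lt_d9]
    _ = 4 * p := by ring

theorem eventually_mul_add_sqrt_le {q : ℕ → ℕ}
    (hq : (fun n => (q n : ℝ)) =o[atTop] fun n => (n : ℝ)) (B : ℕ) :
    ∀ᶠ n in atTop, B * (q n + n.sqrt + 1) ≤ n := by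
  have hc : (0 : ℝ) < 1 / (3 * (B + 1)) := by positivity
  filter_upwards [hq.def hc, eventually_ge_atTop ((3 * B + 1) * (3 * B + 1))] with n h1 h2
  have h3 : 3 * B + 1 ≤ n.sqrt := Nat.le_sqrt.2 h2
  have h4 : 3 * B * n.sqrt ≤ n :=
    (Nat.mul_le_mul_right _ (by omega)).trans (Nat.sqrt_le n)
  have h5 : 3 * B ≤ n := h3.trans (Nat.sqrt_le_self n) |>.trans' (by omega)
  have h6 : 3 * B * q n ≤ n := by
    simp only [Real.norm_natCast] at h1
    rw [one_div, inv_mul_eq_div, le_div_iff₀ (by positivity)] at h1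
    have h7 : (q n : ℝ) * (3 * (B + 1)) = ((q n * (3 * (B + 1)) : ℕ) : ℝ) := by push_cast; ring
    rw [h7] at h1
    have h8 : q n * (3 * (B + 1)) ≤ n := by exact_mod_cast h1
    calc 3 * B * q n ≤ q n * (3 * (B + 1)) := by ring_nf; omega
      _ ≤ n := h8
  have : B * (q n + n.sqrt + 1) * 3 = 3 * B * q n + 3 * B * n.sqrt + 3 * B := by ring
  omega

theorem mainTheorem4 (A : DetAlgorithm) (hA : A.IsLittleOQuery) :
    ∃ f : ℕ → ℕ, Computable f ∧ (∀ n, 0 < f n) ∧ Tendsto f atTop atTop ∧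
      ¬ A.IsLittleOApproximation (fun n => (f n : ℝ) * Real.log n) := by
  obtain ⟨q, hqo, hq⟩ := hA
  obtain ⟨κ, hκ, hκq, hκO⟩ := hq.exists_computable_queries
  obtain ⟨K, hK, hKq, hKκ⟩ := hκ.exists_max_below primrec_tableCount.to_comp q hκq
  -- Here `n.sqrt` is room for `2 ^ p`; it is `o(n)`, while its logarithm is still of order `log n`.
  refine ⟨fun n => n / (K n + n.sqrt + 1) + 1, ?_, fun n => Nat.succ_pos _, ?_, ?_⟩
  · exact Computable.succ.comp (Primrec.nat_div.to_comp.comp Computable.id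
      (Computable.succ.comp (Primrec.nat_add.to_comp.comp hK Primrec.nat_sqrt.to_comp)))
  · refine tendsto_atTop.2 fun B => ?_
    filter_upwards [eventually_mul_add_sqrt_le hqo B] with n hn
    refine Nat.le_succ_of_le ((Nat.le_div_iff_mul_le (Nat.succ_pos _)).2 (le_trans ?_ hn))
    refine Nat.mul_le_mul_left _ ?_
    have := hKq n
    omega
  · rintro ⟨β, hβ, hAβ⟩
    -- Any sufficiently small constant works: `1 / 200` leads to the factor `96 / 200 < 1 / 2` in
    -- `hmain`.
    obtain ⟨n, h1, h2, h3⟩ := ((hβ.def (show (0 : ℝ) < 1 / 200 by norm_num)).and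
      ((eventually_mul_add_sqrt_le hqo 4).and (eventually_ge_atTop 4))).exists
    have hlog := log_le_four_mul_log_sqrt h3
    set s := n.sqrt with hs
    set p := Nat.log 2 s with hp
    have hs2 : 2 ≤ s := Nat.le_sqrt.2 h3
    have hp1 : (1 : ℝ) ≤ p := by exact_mod_cast Nat.log_pos one_lt_two hs2
    have hps : (2 : ℝ) ^ p ≤ s := by exact_mod_cast Nat.pow_log_le_self 2 (by omega)
    have hpn : p ≤ 2 * n := by
      have := Nat.log_le_self 2 s
      have := Nat.sqrt_le_self n
      omega
    obtain ⟨x, hxlt, hx, k, z, hO, y, hy⟩ := hq.exists_bad_table hpn (by omega)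
    -- The bad metric is among the tables over which `K n` is the maximum, and the query count on it
    -- is unique.
    have hkK : k ≤ K n := by
      obtain ⟨z', hz'⟩ := hκO n x hx
      rw [(hO.unique hz').1]
      exact hKκ n x hxlt
    have hkq := hkK.trans (hKq n)
    obtain ⟨k', z', hO', happ⟩ := hAβ n (by omega) hx.metricSpace
    obtain ⟨-, rfl⟩ := hO.unique hO'
    have hnn : ∀ a b, 0 ≤ hx.metricSpace.dist a b := fun a b => Nat.cast_nonneg _
    have happ' := happ.trans (mul_iInf_le_abs_mul _
      (fun i => Finset.sum_nonneg fun v _ => hnn i v) (β n) y)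
    have hY : 0 < ∑ v, hx.metricSpace.dist y v := by
      obtain ⟨v, hv⟩ := Fintype.exists_ne_of_one_lt_card (by rw [Fintype.card_fin]; omega) y
      refine Finset.sum_pos' (fun v _ => hnn y v) ⟨v, Finset.mem_univ v, ?_⟩
      exact (hnn y v).lt_of_ne fun h => hv (hx.metricSpace.eq_of_dist_eq_zero h.symm).symm
    set Y := ∑ v, hx.metricSpace.dist y v with hYdef
    set f := n / (K n + s + 1) + 1 with hf
    have hβn : |β n| ≤ 1 / 200 * (f * (4 * p)) := by
      have hl0 : 0 ≤ Real.log n := Real.log_natCast_nonneg n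
      simp only [Real.norm_eq_abs] at h1
      rw [abs_of_nonneg (mul_nonneg (Nat.cast_nonneg _) hl0)] at h1
      exact h1.trans (by gcongr)
    have hfn : (K n + s + 1 : ℝ) * f ≤ 2 * n := by
      have e1 := Nat.mul_div_le n (K n + s + 1)
      have e2 := hKq n
      have e3 : (K n + s + 1) * f ≤ 2 * n := by rw [hf, mul_add, mul_one]; omega
      exact_mod_cast e3
    have hkn : (n : ℝ) / 2 ≤ n - 2 * k - 1 := by
      have : 4 * (k + 1) ≤ n := by omega
      have : (4 * (k + 1) : ℝ) ≤ n := by exact_mod_cast this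
      linarith
    have hkK' : (k : ℝ) ≤ K n := by exact_mod_cast hkK
    have hn0 : (0 : ℝ) < n := by exact_mod_cast (by omega : 0 < n)
    have hmain : (n : ℝ) / 2 * p * Y ≤ 96 / 200 * (n * p) * Y :=
      calc (n : ℝ) / 2 * p * Y ≤ (n - 2 * k - 1) * p * Y := by gcongr
        _ ≤ 2 * (6 * k + 5 + 2 ^ p) * (|β n| * Y) := hy.trans (by gcongr)
        _ ≤ 2 * (6 * (K n + s + 1)) * (1 / 200 * (f * (4 * p)) * Y) := by
            gcongr
            linarith
        _ = 48 / 200 * p * ((K n + s + 1) * f) * Y := by ring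
        _ ≤ 48 / 200 * p * (2 * n) * Y := by gcongr
        _ = _ := by ring
    have := le_of_mul_le_mul_right hmain hY
    have : 0 < (n : ℝ) * p := by positivity
    linarith
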